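/- Let $d\ge 1$ be an integer and let $\alpha,\lambda,\mu>0$ with $\mu=\alpha=\lambda$. Put $$G(t)=1-\frac{1}{(1+\lambda t)^{\alpha/\lambda}}=1-\frac1{1+\lambda t},$$ and for $n\ge 1$, $1\le j\le n$ let $t_{n,j}$ be the number of permutations $\sigma$ of $\{1,\dots,n\}$ with exactly $j$ components, i.e. such that there are exactly $j$ indices $k\in\{1,\dots,n\}$ with $\sigma(\{1,\dots,k\})=\{1,\dots,k\}$. Consider the linear Volterra integral equation of the second kind $$p(0,t)=1-G(t)-(d-1)\int_0^t G'(t-y)\,p(0,y)\,dy,\qquad 0<t<1/\lambda. \qquad (\ast)$$ (For the continuous-time random walk started at the origin on the star graph formed by $d$ semiaxes $S_1,\dots,S_d$ with common origin $0$, where $k_j$ denotes the $k$-th state of $S_j$, with transition rates $q(0,1_j)=\alpha$, $q(k_j,(k+1)_j)=\alpha+\lambda k$, $q(k_j,(k-1)_j)=\mu k$ for $k\ge1$, this is the integral equation for the probability $p(0,t)$ of being at the origin at time $t$.) Then, for $0<t<1/\lambda$, the series $$p(0,t)=1+\sum_{n=1}^{\infty}\frac{(-\lambda t)^n}{n!}\sum_{j=1}^n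 t_{n,j}\,d^j$$ converges, and it is a solution of $(\ast)$; moreover it is the only one (among functions $p(0,\cdot)$ for which the integrals in $(\ast)$ exist as Lebesgue integrals). -/

import Mathlib

namespace StarBirthDeath

open MeasureTheory

/-- Number of components of a permutation of `{0, …, n-1}`: each component ends at exactly one
position `k ∈ {1, …, n}` such that the first `k` entries of the one-line notation are a permutation
of the `k` smallest values, so these positions are counted. -/
def numComponents {n : ℕ} (σ : Equiv.Perm (Fin n)) : ℕ :=
  ((Finset.Icc 1 n).filter fun k => ∀ i : Fin n, (i : ℕ) < k → (σ i : ℕ) < k).card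

/-- `t_{n,k}`: the number of permutations of an `n`-element linear order with `k` components. -/
def permsWithComponents (n k : ℕ) : ℕ :=
  (Finset.univ.filter fun σ : Equiv.Perm (Fin n) => numComponents σ = k).card

/-- The function `h(t, z; λ, μ)` (with immigration rate `α`). For `λ ≠ μ` the two powers with
exponent `α / λ` are merged into the power of a quotient, since for `λ < μ` numerator and
denominator are both negative. -/
noncomputable def h (α lam μ t z : ℝ) : ℝ :=
  if lam = μ then 1 / (1 + lam * t * (1 - z)) ^ (α / lam)
  else ((lam - μ) / (lam * (1 - z) - (μ - lam * z) * Real.exp (-(lam - μ) * t))) ^ (α / lam)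
    * Real.exp (-(α / lam) * (lam - μ) * t)

/-- `G(t) = 1 - h(t, 0; λ, μ)`. -/
noncomputable def G (α lam μ t : ℝ) : ℝ := 1 - h α lam μ t 0

/-- `p` satisfies, at time `t`, the Volterra equation of the second kind
`p(t) = 1 - G(t) - (d-1) ∫₀ᵗ G'(t-y) p(y) dy`, the integral being a convergent Lebesgue one. -/
def SatisfiesVolterraAt (α lam μ : ℝ) (d : ℕ) (p : ℝ → ℝ) (t : ℝ) : Prop :=
  IntervalIntegrable (fun y => deriv (G α lam μ) (t - y) * p y) volume 0 t ∧
    p t = 1 - G α lam μ t - ((d : ℝ) - 1) * ∫ y in (0 : ℝ)..t, deriv (G α lam μ) (t - y) * p y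

/-- The `n`-th term `((-λ t)^n / n!) ∑_{j=1}^n t_{n,j} d^j` of the series. -/
noncomputable def seriesTerm (lam : ℝ) (d : ℕ) (t : ℝ) (n : ℕ) : ℝ :=
  (-(lam * t)) ^ n / (n.factorial : ℝ)
    * ∑ j ∈ Finset.Icc 1 n, (permsWithComponents n j : ℝ) * (d : ℝ) ^ j

/-- `1 + ∑_{n ≥ 1} ((-λ t)^n / n!) ∑_{j=1}^n t_{n,j} d^j`. -/
noncomputable def seriesSolution (lam : ℝ) (d : ℕ) (t : ℝ) : ℝ :=
  1 + ∑' n : ℕ, seriesTerm lam d t (n + 1)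

end StarBirthDeath

/-! Let `c n` be the sum of `d ^ (number of components)` over the permutations of `n` points
(`componentSum`), so that the series is the sum of `(-λt)^n c n / n!`. Cutting a permutation at the
end of a component gives `c n = n! + (d-1) ∑_{j<n} (n-j)! c j` (`componentSum_eq`).

This is the Volterra equation read coefficientwise: `G'(s) = λ/(1+λs)²` has exponential coefficients
`λ(-λ)^i (i+1)!`, and the convolution of `s^i/i!` with `s^j/j!` is `t^(i+j+1)/(i+j+1)!`. Convergence
for `λt < 1` holds because the recurrence makes `c n / n!` grow only polynomially, which also
justifies the termwise integration.

Uniqueness is of Gronwall type: `0 < G' ≤ λ` bounds the difference of two solutions by `(d-1)λ`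
times the integral of its absolute value, and iterating this forces it to vanish. -/

namespace StarBirthDeath

/-! ### Recurrence for the component polynomial -/

/-- `σ` maps the first `k` elements to themselves. -/
def IsBreak {n : ℕ} (σ : Equiv.Perm (Fin n)) (k : ℕ) : Prop :=
  ∀ i : Fin n, (i : ℕ) < k → (σ i : ℕ) < k

instance {n : ℕ} (σ : Equiv.Perm (Fin n)) : DecidablePred (IsBreak σ) := fun k =>
  inferInstanceAs (Decidable (∀ i : Fin n, (i : ℕ) < k → (σ i : ℕ) < k))

theorem isBreak_zero {n : ℕ} (σ : Equiv.Perm (Fin n)) : IsBreak σ 0 :=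
  fun _ h => absurd h (Nat.not_lt_zero _)

theorem isBreak_self {n : ℕ} (σ : Equiv.Perm (Fin n)) : IsBreak σ n := fun i _ => (σ i).2

theorem numComponents_eq {n : ℕ} (σ : Equiv.Perm (Fin n)) :
    numComponents σ = ((Finset.Icc 1 n).filter (IsBreak σ)).card := rfl

/-- Trades the positions where components end for those where they begin: `n` is exchanged for `0`.
-/
theorem card_filter_Icc_eq_range {P : ℕ → Prop} [DecidablePred P] {n : ℕ} (h0 : P 0) (hn : P n) :
    ((Finset.Icc 1 n).filter P).card = ((Finset.range n).filter P).card := by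
  have h1 : (Finset.range (n + 1)).filter P = insert n ((Finset.range n).filter P) := by
    rw [Finset.range_add_one, Finset.filter_insert, if_pos hn]
  have h2 : (Finset.range (n + 1)).filter P = insert 0 ((Finset.Icc 1 n).filter P) := by
    ext k
    simp only [Finset.mem_filter, Finset.mem_range, Finset.mem_insert, Finset.mem_Icc]
    rcases Nat.eq_zero_or_pos k with rfl | hk
    · simp [h0]
    · constructor
      · rintro ⟨h, hP⟩; exact Or.inr ⟨⟨hk, by omega⟩, hP⟩
      · rintro (h | ⟨⟨_, h⟩, hP⟩)
        · omega
        · exact ⟨by omega, hP⟩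
  have h3 := congrArg Finset.card (h1.symm.trans h2)
  rw [Finset.card_insert_of_notMem (by simp), Finset.card_insert_of_notMem (by simp)] at h3
  omega

/-- The geometric sum `x^m = 1 + (x-1)(1 + x + ⋯ + x^(m-1))`, its terms indexed by the `m` elements
`j < n` satisfying `P`. As `P 0` holds, the elements below such a `j` are as many as those in `[1,
j]`. -/
theorem pow_card_filter_range {R : Type*} [CommRing R] {P : ℕ → Prop} [DecidablePred P] (h0 : P 0)
    (x : R) (n : ℕ) :
    x ^ ((Finset.range n).filter P).card =
      1 + (x - 1) * ∑ j ∈ Finset.range n,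
        if P j then x ^ ((Finset.Icc 1 j).filter P).card else 0 := by
  induction n with
  | zero => simp
  | succ n ih =>
    rw [Finset.sum_range_succ, Finset.range_add_one, Finset.filter_insert]
    by_cases hn : P n
    · rw [if_pos hn, if_pos hn, Finset.card_insert_of_notMem (by simp), pow_succ,
        card_filter_Icc_eq_range h0 hn]
      linear_combination ih
    · rw [if_neg hn, if_neg hn, ih, add_zero]

/-- The generating polynomial of the number of components of the permutations of `n` elements. -/
def componentSum {R : Type*} [CommSemiring R] (x : R) (n : ℕ) : R :=
  ∑ σ : Equiv.Perm (Fin n), x ^ numComponents σ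

/-- The direct sum of two permutations. -/
def directSum {m l : ℕ} (τ : Equiv.Perm (Fin m)) (ρ : Equiv.Perm (Fin l)) :
    Equiv.Perm (Fin (m + l)) :=
  finSumFinEquiv.permCongr (Equiv.sumCongr τ ρ)

theorem directSum_castAdd {m l : ℕ} (τ : Equiv.Perm (Fin m)) (ρ : Equiv.Perm (Fin l)) (i : Fin m) :
    directSum τ ρ (Fin.castAdd l i) = Fin.castAdd l (τ i) := by
  simp [directSum, Equiv.permCongr_apply]

theorem directSum_natAdd {m l : ℕ} (τ : Equiv.Perm (Fin m)) (ρ : Equiv.Perm (Fin l)) (i : Fin l) :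
    directSum τ ρ (Fin.natAdd m i) = Fin.natAdd m (ρ i) := by
  simp [directSum, Equiv.permCongr_apply]

theorem isBreak_directSum {m l : ℕ} (τ : Equiv.Perm (Fin m)) (ρ : Equiv.Perm (Fin l)) {k : ℕ}
    (hk : k ≤ m) : IsBreak (directSum τ ρ) k ↔ IsBreak τ k := by
  constructor
  · intro h i hi
    simpa [directSum_castAdd] using h (Fin.castAdd l i) hi
  · intro h i
    refine Fin.addCases (fun i hi => ?_) (fun i hi => ?_) i
    · simpa [directSum_castAdd] using h i hi
    · simp at hi; omega

theorem exists_directSum_eq {m l : ℕ} (σ : Equiv.Perm (Fin (m + l))) (h : IsBreak σ m) :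
    ∃ (τ : Equiv.Perm (Fin m)) (ρ : Equiv.Perm (Fin l)), directSum τ ρ = σ := by
  have hmem : finSumFinEquiv.symm.permCongr σ ∈
      (Equiv.Perm.sumCongrHom (Fin m) (Fin l)).range := by
    refine Equiv.Perm.mem_sumCongrHom_range_of_perm_mapsTo_inl ?_
    rintro _ ⟨i, rfl⟩
    have hi := h (Fin.castAdd l i) i.2
    refine ⟨⟨_, hi⟩, ?_⟩
    rw [Equiv.permCongr_apply, Equiv.eq_symm_apply]
    simp
  obtain ⟨⟨τ, ρ⟩, hτρ⟩ := hmem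
  refine ⟨τ, ρ, ?_⟩
  change finSumFinEquiv.permCongr (Equiv.Perm.sumCongrHom (Fin m) (Fin l) (τ, ρ)) = σ
  rw [hτρ]
  ext i
  simp [Equiv.permCongr_apply]

theorem directSum_injective {m l : ℕ} : Function.Injective
    fun p : Equiv.Perm (Fin m) × Equiv.Perm (Fin l) => directSum p.1 p.2 := by
  rintro ⟨τ, ρ⟩ ⟨τ', ρ'⟩ h
  exact Equiv.Perm.sumCongrHom_injective (finSumFinEquiv.permCongr.injective h)

/-- A permutation with a break at `m` is uniquely a direct sum `τ ⊕ ρ`. Its breaks up to `m` are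
those of `τ`, and `ρ` is free, whence `l!`. -/
theorem sum_isBreak_pow_card {R : Type*} [CommSemiring R] (x : R) (m l : ℕ) :
    (∑ σ : Equiv.Perm (Fin (m + l)),
      if IsBreak σ m then x ^ ((Finset.Icc 1 m).filter (IsBreak σ)).card else 0) =
      (l.factorial : R) * componentSum x m := by
  rw [← Finset.sum_filter]
  have key : ∑ p : Equiv.Perm (Fin m) × Equiv.Perm (Fin l), x ^ numComponents p.1 =
      ∑ σ ∈ Finset.univ.filter (fun σ : Equiv.Perm (Fin (m + l)) => IsBreak σ m),
        x ^ ((Finset.Icc 1 m).filter (IsBreak σ)).card := by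
    refine Finset.sum_nbij (fun p => directSum p.1 p.2) ?_ directSum_injective.injOn ?_ ?_
    · intro p _
      simpa using (isBreak_directSum p.1 p.2 le_rfl).2 (isBreak_self _)
    · intro σ hσ
      obtain ⟨τ, ρ, h⟩ := exists_directSum_eq σ (by simpa using hσ)
      exact ⟨(τ, ρ), by simp, h⟩
    · intro p _
      rw [numComponents_eq]
      congr 2
      refine Finset.filter_congr fun k hk => ?_
      rw [isBreak_directSum _ _ (Finset.mem_Icc.1 hk).2]
  rw [← key, Fintype.sum_prod_type, componentSum, Finset.mul_sum]
  refine Finset.sum_congr rfl fun τ _ => ?_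
  simp [Fintype.card_perm]

theorem componentSum_eq {R : Type*} [CommRing R] (x : R) (n : ℕ) :
    componentSum x n = n.factorial +
      (x - 1) * ∑ j ∈ Finset.range n, ((n - j).factorial : R) * componentSum x j := by
  have h : ∀ σ : Equiv.Perm (Fin n), x ^ numComponents σ = 1 + (x - 1) * ∑ j ∈ Finset.range n,
      if IsBreak σ j then x ^ ((Finset.Icc 1 j).filter (IsBreak σ)).card else 0 := fun σ => by
    rw [numComponents_eq, card_filter_Icc_eq_range (isBreak_zero σ) (isBreak_self σ),
      pow_card_filter_range (isBreak_zero σ)]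
  rw [componentSum, Finset.sum_congr rfl fun σ _ => h σ, Finset.sum_add_distrib,
    ← Finset.mul_sum, Finset.sum_comm]
  congr 1
  · simp [Fintype.card_perm]
  · congr 1
    refine Finset.sum_congr rfl fun j hj => ?_
    obtain ⟨l, rfl⟩ := Nat.exists_eq_add_of_le (Finset.mem_range.1 hj).le
    rw [sum_isBreak_pow_card, Nat.add_sub_cancel_left]

/-- Groups permutations by number of components. For `n ≥ 1` the position `n` is always a break, so
no permutation is missed by starting at `j = 1`. -/
theorem sum_permsWithComponents {R : Type*} [CommSemiring R] (x : R) {n : ℕ} (hn : 1 ≤ n) :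
    ∑ j ∈ Finset.Icc 1 n, (permsWithComponents n j : R) * x ^ j = componentSum x n := by
  have hmaps : ∀ σ ∈ (Finset.univ : Finset (Equiv.Perm (Fin n))),
      numComponents σ ∈ Finset.Icc 1 n := by
    intro σ _
    rw [Finset.mem_Icc, numComponents_eq]
    refine ⟨Finset.card_pos.2 ⟨n, ?_⟩, (Finset.card_filter_le _ _).trans (by simp)⟩
    simpa using ⟨hn, isBreak_self σ⟩
  rw [componentSum, ← Finset.sum_fiberwise_of_maps_to hmaps]
  refine Finset.sum_congr rfl fun j _ => ?_
  rw [Finset.sum_congr rfl fun σ hσ => by rw [(Finset.mem_filter.1 hσ).2]]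
  simp [permsWithComponents]

theorem componentSum_zero {R : Type*} [CommSemiring R] (x : R) : componentSum x 0 = 1 := by
  simp [componentSum, numComponents]

theorem componentSum_nonneg {x : ℝ} (hx : 0 ≤ x) (n : ℕ) : 0 ≤ componentSum x n :=
  Finset.sum_nonneg fun _ _ => pow_nonneg hx _

/-! ### Polynomial growth of the coefficients -/

/-- Amounts to `n.choose j ≥ (j+1).choose j = j + 1`. -/
theorem factorial_mul_succ_le {j n : ℕ} (h : j < n) :
    (n - j).factorial * j.factorial * (j + 1) ≤ n.factorial := by
  obtain ⟨l, rfl⟩ := Nat.exists_eq_add_of_lt h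
  rw [show j + l + 1 - j = l + 1 by omega, mul_assoc, mul_comm j.factorial, ← Nat.factorial_succ]
  have h1 := Nat.add_choose_mul_factorial_mul_factorial (l+1) j
  have h2 : j + 1 ≤ (l + 1 + j).choose j := by
    simpa using Nat.choose_le_choose j (show j + 1 ≤ l + 1 + j by omega)
  rw [Nat.factorial_succ j, show j + l + 1 = l + 1 + j by omega, ← h1]
  nlinarith [Nat.mul_le_mul_right ((l + 1).factorial * j.factorial) h2]

theorem componentSum_div_factorial_le (e n : ℕ) :
    componentSum ((e : ℝ) + 1) n / n.factorial ≤ ((n + e).choose e : ℝ) := by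
  set b : ℕ → ℝ := fun n => componentSum ((e : ℝ) + 1) n / n.factorial with hb
  -- `V` is the majorant obtained by bounding `(n-j)! j! / n!` by `1/(j+1)` in the recurrence. From
  -- `b n ≤ V n` follows `V (n+1) ≤ V n * (1 + e/(n+1))`, and `(n+e).choose e` satisfies this with
  -- equality.
  set V : ℕ → ℝ := fun n => 1 + e * ∑ j ∈ Finset.range n, b j / (j + 1) with hV
  have hbV : ∀ n, b n ≤ V n := by
    intro n
    simp only [hb, hV]
    rw [div_le_iff₀ (by positivity), componentSum_eq, add_mul, one_mul, add_sub_cancel_right,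
      mul_assoc, Finset.sum_mul]
    refine add_le_add_right (mul_le_mul_of_nonneg_left (Finset.sum_le_sum fun j hj => ?_)
      (Nat.cast_nonneg e)) _
    have h1 : (((n - j).factorial : ℝ) * j.factorial * (j + 1)) ≤ n.factorial := by
      exact_mod_cast factorial_mul_succ_le (Finset.mem_range.1 hj)
    have h2 := componentSum_nonneg (x := (e : ℝ) + 1) (by positivity) j
    rw [div_div, div_mul_eq_mul_div, le_div_iff₀ (by positivity)]
    nlinarith
  have hVC : ∀ n, V n ≤ ((n + e).choose e : ℝ) := by
    intro n
    induction n with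
    | zero => simp [hV]
    | succ n ih =>
      have h1 : V (n + 1) = V n + e * (b n / (n + 1)) := by
        simp only [hV, Finset.sum_range_succ]; ring
      have h2 : (((n + 1 + e).choose e : ℕ) : ℝ) * (n + 1) = ((n + e).choose e : ℝ) * (n + e + 1) := by
        have := Nat.choose_mul_succ_eq (n + e) e
        rw [show n + e + 1 - e = n + 1 by omega] at this
        rw [show n + 1 + e = n + e + 1 by omega]
        exact_mod_cast this.symm
      have h3 : V (n + 1) * (n + 1) ≤ ((n + e).choose e : ℝ) * (n + e + 1) := by
        have h4 : V (n + 1) * (n + 1) = V n * (n + 1) + e * b n := by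
          rw [h1]; field_simp
        rw [h4]
        have h5 : (e : ℝ) * b n ≤ e * ((n + e).choose e : ℝ) := by
          gcongr; exact (hbV n).trans ih
        nlinarith
      rw [← h2] at h3
      exact le_of_mul_le_mul_right h3 (by positivity)
  exact (hbV n).trans (hVC n)

theorem summable_componentSum_div_factorial {d : ℕ} (hd : 1 ≤ d) {r : ℝ} (hr : |r| < 1) :
    Summable fun n : ℕ => |r ^ n / n.factorial * componentSum (d : ℝ) n| := by
  obtain ⟨e, rfl⟩ := Nat.exists_eq_add_of_le' hd
  have h := summable_choose_mul_geometric_of_norm_lt_one e (r := |r|) (by simpa using hr)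
  refine Summable.of_nonneg_of_le (fun _ => abs_nonneg _) (fun n => ?_) h
  have h1 := componentSum_div_factorial_le e n
  have h0 := componentSum_nonneg (x := (e : ℝ) + 1) (by positivity) n
  push_cast
  rw [abs_mul, abs_div, abs_pow, Nat.abs_cast, abs_of_nonneg h0, div_mul_eq_mul_div, mul_div_assoc,
    mul_comm]
  gcongr

/-! ### Convolution of exponential power series -/

open MeasureTheory

/-- A Beta integral. Integration by parts moves one power from `t - y` to `y` with vanishing
boundary terms, so the induction on `i` needs all `j`. -/
theorem integral_sub_pow_div_factorial_mul_pow_div_factorial (t : ℝ) (i j : ℕ) :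
    ∫ y in (0 : ℝ)..t, (t - y) ^ i / i.factorial * (y ^ j / j.factorial) =
      t ^ (i + j + 1) / (i + j + 1).factorial := by
  induction i generalizing j with
  | zero =>
    simp only [pow_zero, Nat.factorial_zero, Nat.cast_one, div_one, one_mul, zero_add,
      intervalIntegral.integral_div, integral_pow, Nat.factorial_succ, Nat.cast_mul]
    rw [zero_pow (Nat.succ_ne_zero j), sub_zero, div_div]
    push_cast
    rfl
  | succ i ih =>
    have hu : ∀ y ∈ Set.uIcc 0 t, HasDerivAt (fun y : ℝ => (t - y) ^ (i + 1) / (i + 1).factorial)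
        (-((t - y) ^ i / i.factorial)) y := fun y _ => by
      have h := (((hasDerivAt_id y).const_sub t).pow (i + 1)).div_const ((i + 1).factorial : ℝ)
      refine h.congr_deriv ?_
      rw [Nat.factorial_succ]
      simp only [id, Nat.cast_mul, Nat.add_sub_cancel]
      field_simp
    have hv : ∀ y ∈ Set.uIcc 0 t, HasDerivAt (fun y : ℝ => y ^ (j + 1) / (j + 1).factorial)
        (y ^ j / j.factorial) y := fun y _ => by
      refine ((hasDerivAt_pow (j + 1) y).div_const _).congr_deriv ?_
      rw [Nat.factorial_succ]
      simp only [Nat.cast_mul, Nat.add_sub_cancel]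
      field_simp
    rw [intervalIntegral.integral_mul_deriv_eq_deriv_mul hu hv
      (Continuous.intervalIntegrable (by fun_prop) _ _)
      (Continuous.intervalIntegrable (by fun_prop) _ _)]
    simp only [sub_self, ne_eq, Nat.succ_ne_zero, not_false_eq_true, zero_pow, zero_div, zero_mul,
      mul_zero, neg_mul, intervalIntegral.integral_neg, sub_neg_eq_add, zero_add]
    rw [ih, show i + (j + 1) + 1 = i + 1 + j + 1 by omega]

theorem hasSum_mul_of_summable_norm {f g : ℕ → ℝ} (hf : Summable fun n => ‖f n‖)
    (hg : Summable fun n => ‖g n‖) :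
    HasSum (fun ij : ℕ × ℕ => f ij.1 * g ij.2) ((∑' n, f n) * ∑' n, g n) :=
  hf.of_norm.hasSum.mul hg.of_norm.hasSum (summable_mul_of_summable_norm hf hg)

section PowerSeries

variable {u v : ℕ → ℝ} {t : ℝ}

theorem norm_mul_pow_div_factorial_le {y : ℝ} (hy : y ∈ Set.Icc 0 t) (n : ℕ) :
    ‖u n * (y ^ n / n.factorial)‖ ≤ |u n * (t ^ n / n.factorial)| := by
  have h0 := hy.1
  have h1 := hy.2
  have h2 := h0.trans h1
  rw [Real.norm_eq_abs, abs_mul, abs_mul,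
    abs_of_nonneg (show 0 ≤ y ^ n / (n.factorial : ℝ) by positivity),
    abs_of_nonneg (show 0 ≤ t ^ n / (n.factorial : ℝ) by positivity)]
  gcongr

theorem continuousOn_tsum_mul_pow_div_factorial
    (hu : Summable fun n => |u n * (t ^ n / n.factorial)|) :
    ContinuousOn (fun y => ∑' n, u n * (y ^ n / n.factorial)) (Set.Icc 0 t) :=
  continuousOn_tsum (fun n => by fun_prop) hu fun n _ hy => norm_mul_pow_div_factorial_le hy n

theorem intervalIntegrable_convolution (ht : 0 ≤ t)
    (hu : Summable fun n => |u n * (t ^ n / n.factorial)|)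
    (hv : Summable fun n => |v n * (t ^ n / n.factorial)|) :
    IntervalIntegrable (fun y => (∑' n, u n * ((t - y) ^ n / n.factorial)) *
      ∑' n, v n * (y ^ n / n.factorial)) volume 0 t := by
  refine ContinuousOn.intervalIntegrable ?_
  rw [Set.uIcc_of_le ht]
  refine ContinuousOn.mul ?_ (continuousOn_tsum_mul_pow_div_factorial hv)
  refine (continuousOn_tsum_mul_pow_div_factorial hu).comp (f := fun y => t - y)
    (by fun_prop) fun y hy => ?_
  exact ⟨by linarith [hy.2], by linarith [hy.1]⟩

/-- The convolution of two exponential generating functions, term by term. -/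
theorem hasSum_integral_convolution (ht : 0 ≤ t)
    (hu : Summable fun n => |u n * (t ^ n / n.factorial)|)
    (hv : Summable fun n => |v n * (t ^ n / n.factorial)|) :
    HasSum (fun n => (∑ ij ∈ Finset.HasAntidiagonal.antidiagonal n, u ij.1 * v ij.2) *
        (t ^ (n + 1) / (n + 1).factorial))
      (∫ y in (0 : ℝ)..t, (∑' n, u n * ((t - y) ^ n / n.factorial)) *
        ∑' n, v n * (y ^ n / n.factorial)) := by
  have hprod : HasSum (fun ij : ℕ × ℕ => u ij.1 * v ij.2 *
        (t ^ (ij.1 + ij.2 + 1) / (ij.1 + ij.2 + 1).factorial))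
      (∫ y in (0 : ℝ)..t, (∑' n, u n * ((t - y) ^ n / n.factorial)) *
        ∑' n, v n * (y ^ n / n.factorial)) := by
    have hterm : ∀ ij : ℕ × ℕ, u ij.1 * v ij.2 *
        (t ^ (ij.1 + ij.2 + 1) / (ij.1 + ij.2 + 1).factorial) =
        ∫ y in (0 : ℝ)..t, (u ij.1 * ((t - y) ^ ij.1 / ij.1.factorial)) *
          (v ij.2 * (y ^ ij.2 / ij.2.factorial)) := fun ij => by
      rw [← integral_sub_pow_div_factorial_mul_pow_div_factorial,
        ← intervalIntegral.integral_const_mul]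
      refine intervalIntegral.integral_congr fun y _ => ?_
      ring
    simp only [hterm]
    have hsum : Summable fun ij : ℕ × ℕ => |u ij.1 * (t ^ ij.1 / ij.1.factorial)| *
        |v ij.2 * (t ^ ij.2 / ij.2.factorial)| :=
      hu.mul_of_nonneg hv (fun _ => abs_nonneg _) (fun _ => abs_nonneg _)
    have hmem : ∀ y ∈ Set.uIoc 0 t, y ∈ Set.Icc 0 t ∧ t - y ∈ Set.Icc 0 t := fun y hy => by
      rw [Set.uIoc_of_le ht] at hy
      exact ⟨⟨hy.1.le, hy.2⟩, by linarith [hy.2], by linarith [hy.1]⟩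
    -- On `[0, t]` each monomial is largest at `t`, so the bounds do not depend on `y`.
    refine intervalIntegral.hasSum_integral_of_dominated_convergence
      (fun ij _ => |u ij.1 * (t ^ ij.1 / ij.1.factorial)| *
        |v ij.2 * (t ^ ij.2 / ij.2.factorial)|) (fun ij => ?_) (fun ij => ?_) ?_ ?_ ?_
    · exact Continuous.aestronglyMeasurable (by fun_prop)
    · refine Filter.Eventually.of_forall fun y hy => ?_
      rw [norm_mul]
      exact mul_le_mul (norm_mul_pow_div_factorial_le (hmem y hy).2 _)
        (norm_mul_pow_div_factorial_le (hmem y hy).1 _) (norm_nonneg _) (abs_nonneg _)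
    · exact Filter.Eventually.of_forall fun _ _ => hsum
    · exact intervalIntegrable_const
    · refine Filter.Eventually.of_forall fun y hy => ?_
      have h1 : Summable fun n => ‖u n * ((t - y) ^ n / n.factorial)‖ :=
        Summable.of_nonneg_of_le (fun _ => norm_nonneg _) (fun n => norm_mul_pow_div_factorial_le (hmem y hy).2 n) hu
      have h2 : Summable fun n => ‖v n * (y ^ n / n.factorial)‖ :=
        Summable.of_nonneg_of_le (fun _ => norm_nonneg _) (fun n => norm_mul_pow_div_factorial_le (hmem y hy).1 n) hv
      exact hasSum_mul_of_summable_norm (f := fun n => u n * ((t - y) ^ n / n.factorial))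
        (g := fun n => v n * (y ^ n / n.factorial)) h1 h2
  -- The double series is regrouped by `i + j = n`.
  refine (Finset.HasAntidiagonal.sigmaAntidiagonalEquivProd.hasSum_iff.2 hprod).sigma fun n => ?_
  have hfib : (∑ ij ∈ Finset.HasAntidiagonal.antidiagonal n, u ij.1 * v ij.2) *
      (t ^ (n + 1) / (n + 1).factorial) = ∑ c : Finset.HasAntidiagonal.antidiagonal n,
        u c.1.1 * v c.1.2 * (t ^ (c.1.1 + c.1.2 + 1) / (c.1.1 + c.1.2 + 1).factorial) := by
    rw [Finset.sum_mul, ← Finset.sum_coe_sort]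
    refine Finset.sum_congr rfl fun c _ => ?_
    rw [Finset.HasAntidiagonal.mem_antidiagonal.1 c.2]
  rw [hfib]
  exact hasSum_fintype _

end PowerSeries

/-! ### Gronwall-type vanishing -/

/-- A locally integrable function dominated by a multiple of its own primitive vanishes. -/
theorem eq_zero_of_abs_le_integral {w : ℝ → ℝ} {T C : ℝ} (hC : 0 ≤ C)
    (hint : ∀ t ∈ Set.Ioo 0 T, IntervalIntegrable w volume 0 t)
    (hle : ∀ t ∈ Set.Ioo 0 T, |w t| ≤ C * ∫ y in (0 : ℝ)..t, |w y|) :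
    ∀ t ∈ Set.Ioo 0 T, w t = 0 := by
  intro t₀ ht₀
  have hsub : ∀ {t}, t ∈ Set.Ioc 0 t₀ → t ∈ Set.Ioo 0 T := fun ht => ⟨ht.1, ht.2.trans_lt ht₀.2⟩
  set M := C * ∫ y in (0 : ℝ)..t₀, |w y| with hM
  -- Inserting the bound for `n` into the hypothesis gives the one for `n + 1`; `M` comes from the
  -- integral over all of `[0, t₀]`.
  have hbound : ∀ n : ℕ, ∀ t ∈ Set.Ioc 0 t₀, |w t| ≤ M * ((C * t) ^ n / n.factorial) := by
    intro n
    induction n with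
    | zero =>
      intro t ht
      refine (hle t (hsub ht)).trans ?_
      simp only [pow_zero, Nat.factorial_zero, Nat.cast_one, div_one, mul_one, hM]
      refine mul_le_mul_of_nonneg_left ?_ hC
      exact intervalIntegral.integral_mono_interval le_rfl ht.1.le ht.2
        (Filter.Eventually.of_forall fun _ => abs_nonneg _) (hint t₀ ht₀).abs
    | succ n ih =>
      intro t ht
      refine (hle t (hsub ht)).trans ?_
      have h1 : ∫ y in (0 : ℝ)..t, |w y| ≤ ∫ y in (0 : ℝ)..t, M * ((C * y) ^ n / n.factorial) := by
        refine intervalIntegral.integral_mono_on_of_le_Ioo ht.1.le (hint t (hsub ht)).abs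
          (Continuous.intervalIntegrable (by fun_prop) _ _) fun y hy => ?_
        exact ih y ⟨hy.1, hy.2.le.trans ht.2⟩
      refine (mul_le_mul_of_nonneg_left h1 hC).trans_eq ?_
      simp only [mul_pow, intervalIntegral.integral_const_mul, intervalIntegral.integral_div,
        integral_pow]
      rw [Nat.factorial_succ]
      push_cast
      field_simp
      ring
  have hlim := (FloorSemiring.tendsto_pow_div_factorial_atTop (C * t₀)).const_mul M
  rw [mul_zero] at hlim
  exact abs_nonpos_iff.1 (ge_of_tendsto' hlim fun n => hbound n t₀ ⟨ht₀.1, le_rfl⟩)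

/-! ### The Volterra equation for equal rates -/

section Equation

variable {lam : ℝ}

theorem deriv_G (hlam : 0 < lam) {s : ℝ} (hs : 0 ≤ s) :
    deriv (G lam lam lam) s = lam / (1 + lam * s) ^ 2 := by
  have hG : G lam lam lam = fun t => 1 - (1 + lam * t)⁻¹ := by
    ext t; simp [G, h, div_self hlam.ne']
  have hne : 1 + lam * s ≠ 0 := by positivity
  rw [hG]
  have h1 : HasDerivAt (fun t : ℝ => 1 + lam * t) lam s := by
    simpa using ((hasDerivAt_id s).const_mul lam).const_add 1
  refine (((h1.inv hne).const_sub 1).congr_deriv ?_).deriv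
  ring

theorem one_sub_G (hlam : 0 < lam) (t : ℝ) : 1 - G lam lam lam t = (1 + lam * t)⁻¹ := by
  simp [G, h, div_self hlam.ne']

theorem abs_neg_mul_lt_one (hlam : 0 < lam) {s : ℝ} (h0 : 0 ≤ s) (h1 : s < 1 / lam) :
    |-(lam * s)| < 1 := by
  rw [abs_neg, abs_of_nonneg (by positivity), mul_comm]
  exact (lt_div_iff₀ hlam).1 h1

/-- Puts the kernel in the form of the negative binomial series of `λ(1+λs)⁻²`. -/
theorem kernel_term_eq (s : ℝ) (n : ℕ) :
    lam * (-lam) ^ n * (n + 1).factorial * (s ^ n / n.factorial) =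
      lam * ((n + 1).choose 1 * (-(lam * s)) ^ n) := by
  rw [Nat.factorial_succ, Nat.choose_one_right, ← neg_mul, mul_pow]
  push_cast
  field_simp

theorem summable_kernel (hlam : 0 < lam) {s : ℝ} (h0 : 0 ≤ s) (h1 : s < 1 / lam) :
    Summable fun n : ℕ =>
      |lam * (-lam) ^ n * (n + 1).factorial * (s ^ n / n.factorial)| := by
  simp only [kernel_term_eq]
  exact ((summable_choose_mul_geometric_of_norm_lt_one 1
    (abs_neg_mul_lt_one hlam h0 h1)).mul_left lam).abs

theorem tsum_kernel (hlam : 0 < lam) {s : ℝ} (h0 : 0 ≤ s) (h1 : s < 1 / lam) :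
    ∑' n : ℕ, lam * (-lam) ^ n * (n + 1).factorial * (s ^ n / n.factorial) =
      deriv (G lam lam lam) s := by
  simp only [kernel_term_eq]
  rw [tsum_mul_left, tsum_choose_mul_geometric_of_norm_lt_one 1 (abs_neg_mul_lt_one hlam h0 h1),
    deriv_G hlam h0]
  ring

theorem solution_term_eq (d : ℕ) (s : ℝ) (n : ℕ) :
    (-lam) ^ n * componentSum (d : ℝ) n * (s ^ n / n.factorial) =
      (-(lam * s)) ^ n / n.factorial * componentSum (d : ℝ) n := by
  rw [← neg_mul, mul_pow]; ring

theorem summable_solution {d : ℕ} (hd : 1 ≤ d) (hlam : 0 < lam) {s : ℝ} (h0 : 0 ≤ s)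
    (h1 : s < 1 / lam) :
    Summable fun n : ℕ => |(-lam) ^ n * componentSum (d : ℝ) n * (s ^ n / n.factorial)| := by
  simp only [solution_term_eq]
  exact summable_componentSum_div_factorial hd (abs_neg_mul_lt_one hlam h0 h1)

theorem seriesTerm_succ (d : ℕ) (s : ℝ) (n : ℕ) :
    seriesTerm lam d s (n + 1) =
      (-lam) ^ (n + 1) * componentSum (d : ℝ) (n + 1) * (s ^ (n + 1) / (n + 1).factorial) := by
  rw [solution_term_eq, seriesTerm, sum_permsWithComponents _ (Nat.le_add_left 1 n)]

theorem seriesSolution_eq {d : ℕ} (hd : 1 ≤ d) (hlam : 0 < lam) {s : ℝ} (h0 : 0 ≤ s)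
    (h1 : s < 1 / lam) :
    seriesSolution lam d s =
      ∑' n : ℕ, (-lam) ^ n * componentSum (d : ℝ) n * (s ^ n / n.factorial) := by
  rw [(summable_solution hd hlam h0 h1).of_abs.tsum_eq_zero_add]
  simp [seriesSolution, seriesTerm_succ, componentSum_zero]

/-- `componentSum_eq` scaled by `(-λ)^(n+1)`. For `i + j = n` the powers multiply to `λ(-λ)^n =
-(-λ)^(n+1)`, which accounts for the minus sign before `d - 1`. -/
theorem solution_coeff_succ (d n : ℕ) :
    (-lam) ^ (n + 1) * componentSum (d : ℝ) (n + 1) =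
      (-lam) ^ (n + 1) * (n + 1).factorial - ((d : ℝ) - 1) *
        ∑ ij ∈ Finset.HasAntidiagonal.antidiagonal n, (lam * (-lam) ^ ij.1 * (ij.1 + 1).factorial) *
          ((-lam) ^ ij.2 * componentSum (d : ℝ) ij.2) := by
  have h : ∑ ij ∈ Finset.HasAntidiagonal.antidiagonal n, (lam * (-lam) ^ ij.1 * (ij.1 + 1).factorial) *
      ((-lam) ^ ij.2 * componentSum (d : ℝ) ij.2) = -(-lam) ^ (n + 1) *
        ∑ j ∈ Finset.range (n + 1), ((n + 1 - j).factorial : ℝ) * componentSum (d : ℝ) j := by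
    rw [Finset.mul_sum, ← Finset.Nat.sum_antidiagonal_swap,
      Finset.Nat.sum_antidiagonal_eq_sum_range_succ_mk]
    refine Finset.sum_congr rfl fun j hj => ?_
    have hj' : j ≤ n := Nat.lt_succ_iff.1 (Finset.mem_range.1 hj)
    obtain ⟨i, rfl⟩ := Nat.exists_eq_add_of_le hj'
    simp only [Prod.swap, Nat.add_sub_cancel_left, show j + i + 1 - j = i + 1 by omega]
    ring
  rw [h, componentSum_eq]
  ring

theorem satisfiesVolterraAt_seriesSolution {d : ℕ} (hd : 1 ≤ d) (hlam : 0 < lam) {t : ℝ}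
    (ht : t ∈ Set.Ioo 0 (1 / lam)) :
    SatisfiesVolterraAt lam lam lam d (seriesSolution lam d) t := by
  obtain ⟨h0, h1⟩ := ht
  have hu := summable_kernel hlam h0.le h1
  have hv := summable_solution hd hlam h0.le h1
  have heq : Set.EqOn (fun y => (∑' n : ℕ, lam * (-lam) ^ n * (n + 1).factorial *
      ((t - y) ^ n / n.factorial)) *
      ∑' n : ℕ, (-lam) ^ n * componentSum (d : ℝ) n * (y ^ n / n.factorial))
      (fun y => deriv (G lam lam lam) (t - y) * seriesSolution lam d y) (Set.uIcc 0 t) := by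
    intro y hy
    rw [Set.uIcc_of_le h0.le] at hy
    simp only
    rw [tsum_kernel hlam (by linarith [hy.2]) (by linarith [hy.1]),
      seriesSolution_eq hd hlam hy.1 (hy.2.trans_lt h1)]
  refine ⟨(intervalIntegrable_convolution h0.le hu hv).congr
    fun y hy => heq (Set.uIoc_subset_uIcc hy), ?_⟩
  have hconv := hasSum_integral_convolution h0.le hu hv
  rw [intervalIntegral.integral_congr heq] at hconv
  -- The expansion of `1 - G` without its constant term, which is the separate `1` in
  -- `seriesSolution`.
  have hgeom : HasSum (fun n : ℕ => (-(lam * t)) ^ (n + 1)) ((1 + lam * t)⁻¹ - 1) := by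
    have h := hasSum_geometric_of_abs_lt_one (abs_neg_mul_lt_one hlam h0.le h1)
    rw [← hasSum_nat_add_iff' 1] at h
    simpa using h
  have hsum := hgeom.sub (hconv.mul_left ((d : ℝ) - 1))
  have hterm : ∀ n : ℕ, (-(lam * t)) ^ (n + 1) - ((d : ℝ) - 1) *
      ((∑ ij ∈ Finset.HasAntidiagonal.antidiagonal n, (lam * (-lam) ^ ij.1 * (ij.1 + 1).factorial) *
          ((-lam) ^ ij.2 * componentSum (d : ℝ) ij.2)) * (t ^ (n + 1) / (n + 1).factorial)) =
      seriesTerm lam d t (n + 1) := fun n => by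
    rw [seriesTerm_succ, solution_coeff_succ, sub_mul, ← neg_mul, mul_pow]
    field_simp
  simp only [hterm] at hsum
  rw [seriesSolution, hsum.tsum_eq, one_sub_G hlam]
  ring

theorem continuousOn_deriv_G_sub (hlam : 0 < lam) {t : ℝ} (ht : 0 ≤ t) :
    ContinuousOn (fun y => (deriv (G lam lam lam) (t - y))⁻¹) (Set.uIcc 0 t) := by
  rw [Set.uIcc_of_le ht]
  have h : ContinuousOn (fun y => (lam / (1 + lam * (t - y)) ^ 2)⁻¹) (Set.Icc 0 t) := by
    simp only [inv_div]
    fun_prop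
  exact h.congr fun y hy => by rw [deriv_G hlam (by linarith [hy.2])]

/-- The equation only provides integrability of kernel times `p`; the kernel has a continuous
reciprocal on `[0, t]`, so it can be divided out. -/
theorem SatisfiesVolterraAt.intervalIntegrable {d : ℕ} {p : ℝ → ℝ} (hlam : 0 < lam) {t : ℝ}
    (ht : 0 ≤ t) (hp : SatisfiesVolterraAt lam lam lam d p t) :
    IntervalIntegrable p volume 0 t := by
  refine (hp.1.continuousOn_mul (continuousOn_deriv_G_sub hlam ht)).congr fun y hy => ?_
  rw [Set.uIoc_of_le ht] at hy
  have hy0 : 0 ≤ t - y := by linarith [hy.2]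
  have hne : deriv (G lam lam lam) (t - y) ≠ 0 := by rw [deriv_G hlam hy0]; positivity
  field_simp

theorem SatisfiesVolterraAt.unique {d : ℕ} {p q : ℝ → ℝ} {T : ℝ} (hd : 1 ≤ d) (hlam : 0 < lam)
    (hp : ∀ t ∈ Set.Ioo 0 T, SatisfiesVolterraAt lam lam lam d p t)
    (hq : ∀ t ∈ Set.Ioo 0 T, SatisfiesVolterraAt lam lam lam d q t) :
    ∀ t ∈ Set.Ioo 0 T, p t = q t := by
  have hd' : (0 : ℝ) ≤ d - 1 := sub_nonneg.2 (by exact_mod_cast hd)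
  suffices h : ∀ t ∈ Set.Ioo 0 T, p t - q t = 0 from fun t ht => sub_eq_zero.1 (h t ht)
  have hint : ∀ t ∈ Set.Ioo 0 T, IntervalIntegrable (fun y => p y - q y) volume 0 t :=
    fun t ht => ((hp t ht).intervalIntegrable hlam ht.1.le).sub
      ((hq t ht).intervalIntegrable hlam ht.1.le)
  -- The constant comes from `G' ≤ λ` on the nonnegative half-line.
  refine eq_zero_of_abs_le_integral (C := (d - 1) * lam) (by positivity) hint fun t ht => ?_
  have hk := (hp t ht).1.sub (hq t ht).1
  have heq : p t - q t = -((d - 1) * ∫ y in (0 : ℝ)..t,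
      (deriv (G lam lam lam) (t - y) * p y - deriv (G lam lam lam) (t - y) * q y)) := by
    rw [intervalIntegral.integral_sub (hp t ht).1 (hq t ht).1, (hp t ht).2, (hq t ht).2]
    ring
  rw [heq, abs_neg, abs_mul, abs_of_nonneg hd', mul_assoc, ← intervalIntegral.integral_const_mul]
  refine mul_le_mul_of_nonneg_left ?_ hd'
  refine (intervalIntegral.abs_integral_le_integral_abs ht.1.le).trans ?_
  refine intervalIntegral.integral_mono_on ht.1.le hk.abs ((hint t ht).abs.const_mul lam)
    fun y hy => ?_
  have hy0 : 0 ≤ t - y := by linarith [hy.2]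
  rw [← mul_sub, abs_mul, deriv_G hlam hy0, abs_of_nonneg (by positivity)]
  refine mul_le_mul_of_nonneg_right (div_le_self hlam.le (one_le_pow₀ ?_)) (abs_nonneg _)
  nlinarith [mul_nonneg hlam.le hy0]

end Equation

end StarBirthDeath

theorem mainTheorem4 (d : ℕ) (hd : 1 ≤ d) (α lam μ : ℝ) (hlam : 0 < lam)
    (hμα : μ = α) (hαlam : α = lam) :
    -- the series converges on `(0, 1/λ)`
    (∀ t ∈ Set.Ioo (0 : ℝ) (1 / lam),
      Summable fun n : ℕ => StarBirthDeath.seriesTerm lam d t (n + 1)) ∧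
    -- its sum solves the Volterra equation there
    (∀ t ∈ Set.Ioo (0 : ℝ) (1 / lam),
      StarBirthDeath.SatisfiesVolterraAt α lam μ d (StarBirthDeath.seriesSolution lam d) t) ∧
    -- and every solution is given by the series
    (∀ p : ℝ → ℝ,
      (∀ t ∈ Set.Ioo (0 : ℝ) (1 / lam), StarBirthDeath.SatisfiesVolterraAt α lam μ d p t) →
      ∀ t ∈ Set.Ioo (0 : ℝ) (1 / lam), p t = StarBirthDeath.seriesSolution lam d t) := by
  subst hαlam hμα
  refine ⟨fun t ht => ?_, fun t ht => StarBirthDeath.satisfiesVolterraAt_seriesSolution hd hlam ht,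
    fun p hp => StarBirthDeath.SatisfiesVolterraAt.unique hd hlam hp fun t ht =>
      StarBirthDeath.satisfiesVolterraAt_seriesSolution hd hlam ht⟩
  simp only [StarBirthDeath.seriesTerm_succ]
  exact (summable_nat_add_iff 1).2 (StarBirthDeath.summable_solution hd hlam ht.1.le ht.2).of_abs
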